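/- Let $X$ be a set of $n$ alternatives. A set $\mathcal{D}$ of linear orders on $X$ is a Condorcet domain if, for every profile consisting of an odd number of linear orders from $\mathcal{D}$ (repetitions allowed), the majority relation of the profile ($a$ is above $b$ if more orders of the profile rank $a$ above $b$ than rank $b$ above $a$) is transitive. Let $f(n)$ be the maximum size of a Condorcet domain on a set of $n$ alternatives. Theorem. The limit $\lim_{n\to\infty} f(n)^{1/n}$ exists (as a real number) and $$\lim_{n\to\infty} f(n)^{1/n}\ \ge\ 2.198139 .$$ Moreover $f(n)=\Omega(2.198139^n)$, that is, there are a constant $c>0$ and an $n_0$ such that $f(n)\ge c\cdot 2.198139^{\,n}$ for all $n\ge n_0$. -/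

import Mathlib

open Filter Topology Asymptotics

namespace CondorcetDomain

/-- A linear order (preference order) on the set `Fin n` of `n` alternatives, given as the bijection
that sends every alternative to its position in the order; position `0` is the most preferred.
Distinct bijections give distinct linear orders and every linear order on `Fin n` arises so. -/
abbrev Pref (n : ℕ) : Type := Equiv.Perm (Fin n)

/-- In the preference order `P`, the alternative `a` is ranked strictly above `b`. -/
abbrev Prefers {n : ℕ} (P : Pref n) (a b : Fin n) : Prop := P a < P b

/-- The (strict) majority relation of a profile `P` of `k` agents: more agents rank `a` above `b`
than rank `b` above `a`. -/
def Majority {n k : ℕ} (P : Fin k → Pref n) (a b : Fin n) : Prop :=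
  (Finset.univ.filter fun i => Prefers (P i) b a).card <
    (Finset.univ.filter fun i => Prefers (P i) a b).card

/-- A domain is a Condorcet domain if the majority relation of every profile with an odd number of
agents, all of whose preferences belong to the domain, is transitive. -/
def IsCondorcetDomain {n : ℕ} (D : Finset (Pref n)) : Prop :=
  ∀ k : ℕ, Odd k → ∀ P : Fin k → Pref n, (∀ i, P i ∈ D) →
    ∀ a b c : Fin n, Majority P a b → Majority P b c → Majority P a c

open Classical in
/-- `f n` is the maximum size of a Condorcet domain on `n` alternatives. -/
noncomputable def f (n : ℕ) : ℕ :=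
  (Finset.univ.filter fun D : Finset (Pref n) => IsCondorcetDomain D).sup Finset.card

end CondorcetDomain

/-! Condorcet domains are exactly the domains in which no three orders induce the three cyclic
shifts of a triple (`isCondorcetDomain_iff_isCycleFree`); everything below works with this local
condition.

Existence of the limit: replacing one alternative of a domain by a block carrying another domain
preserves cycle-freeness and multiplies sizes, so `f (n + 1) * f (m + 1) ≤ f (n + m + 1)`
(`f_mul_f_le`). Thus `-log f (n + 1)` is subadditive and Fekete's lemma applies. Finiteness of the
limit needs an exponential upper bound. It comes from double counting pairs of an order and an
alternative that can be moved to few other places inside the domain, which gives `f (k + 3) ≤ 12 * f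
(k + 2)` (`f_succ_le`).

Lower bound: the Fekete limit is an infimum, so one good domain suffices. Orders correspond to
maximal chains of subsets. If all chains stay in a set family that shatters no triple, the orders
are cycle free (`isCycleFree_domainOf`). An explicit family on 18 elements has at least 675512
maximal chains, as a count by cardinality layers verifies (`le_f_eighteen`). Since substitution
loses one alternative, the resulting rate is the 17th root, about 2.2025. -/

namespace CondorcetDomain

/-! ### Majority cycles and cyclic triples -/

/-- A domain is cycle free if no three of its orders rank three alternatives in the three cyclic
shifts of one order. -/
def IsCycleFree {n : ℕ} (D : Finset (Pref n)) : Prop :=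
  ∀ a b c : Fin n, ∀ P ∈ D, ∀ Q ∈ D, ∀ R ∈ D,
    Prefers P a b → Prefers P b c → Prefers Q b c → Prefers Q c a →
      Prefers R c a → Prefers R a b → False

lemma card_prefers_add_card_prefers {n k : ℕ} (P : Fin k → Pref n) {a b : Fin n} (h : a ≠ b) :
    (Finset.univ.filter fun i => Prefers (P i) a b).card +
      (Finset.univ.filter fun i => Prefers (P i) b a).card = k := by
  have h1 : (Finset.univ.filter fun i => Prefers (P i) b a) =
      Finset.univ.filter fun i => ¬ Prefers (P i) a b := by
    ext i
    have : P i a ≠ P i b := fun e => h ((P i).injective e)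
    simp only [Finset.mem_filter, Finset.mem_univ, true_and, Prefers]
    omega
  rw [h1, Finset.card_filter_add_card_filter_not, Finset.card_univ, Fintype.card_fin]

/-- Two strict majorities of the same electorate overlap. -/
lemma exists_prefers_of_majority {n k : ℕ} (P : Fin k → Pref n) {a b c d : Fin n}
    (h₁ : Majority P a b) (h₂ : Majority P c d) :
    ∃ i, Prefers (P i) a b ∧ Prefers (P i) c d := by
  by_contra! h
  have hab : a ≠ b := by rintro rfl; exact lt_irrefl _ h₁
  have hcd : c ≠ d := by rintro rfl; exact lt_irrefl _ h₂
  have e₁ := card_prefers_add_card_prefers P hab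
  have e₂ := card_prefers_add_card_prefers P hcd
  have hsub : (Finset.univ.filter fun i => Prefers (P i) a b) ⊆
      Finset.univ.filter fun i => Prefers (P i) d c := by
    intro i hi
    simp only [Finset.mem_filter, Finset.mem_univ, true_and] at hi ⊢
    have h3 := h i hi
    have : P i c ≠ P i d := fun e => hcd ((P i).injective e)
    simp only [Prefers] at h3 ⊢
    omega
  have := Finset.card_le_card hsub
  simp only [Majority] at h₁ h₂
  omega

lemma IsCycleFree.isCondorcetDomain {n : ℕ} {D : Finset (Pref n)} (hD : IsCycleFree D) :
    IsCondorcetDomain D := by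
  intro k hk P hP a b c hab hbc
  by_contra hac
  have hne : c ≠ a := by
    rintro rfl
    exact lt_asymm hab hbc
  -- An odd electorate has no ties, so the failure of `a` over `c` is a majority for `c` over `a`.
  have hca : Majority P c a := by
    have e := card_prefers_add_card_prefers P hne
    simp only [Majority] at hac ⊢
    obtain ⟨r, rfl⟩ := hk
    omega
  obtain ⟨i, hi, hi'⟩ := exists_prefers_of_majority P hab hbc
  obtain ⟨j, hj, hj'⟩ := exists_prefers_of_majority P hbc hca
  obtain ⟨l, hl, hl'⟩ := exists_prefers_of_majority P hca hab
  exact hD a b c _ (hP i) _ (hP j) _ (hP l) hi hi' hj hj' hl hl'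

lemma majority_of_two {n : ℕ} {P : Fin 3 → Pref n} {a b : Fin n} {i j : Fin 3} (hij : i ≠ j)
    (hi : Prefers (P i) a b) (hj : Prefers (P j) a b) : Majority P a b := by
  have hab : a ≠ b := by rintro rfl; exact lt_irrefl _ hi
  have h : ({i, j} : Finset (Fin 3)) ⊆ Finset.univ.filter fun i => Prefers (P i) a b := by
    intro l hl
    simp only [Finset.mem_insert, Finset.mem_singleton] at hl
    rcases hl with rfl | rfl <;> simpa
  have h2 := Finset.card_le_card h
  rw [Finset.card_pair hij] at h2
  have e := card_prefers_add_card_prefers P hab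
  unfold Majority
  omega

/-- The three orders of a cyclic triple form a three-voter profile in which each of the comparisons
`ab`, `bc`, `ca` has two supporters. -/
lemma IsCondorcetDomain.isCycleFree {n : ℕ} {D : Finset (Pref n)} (hD : IsCondorcetDomain D) :
    IsCycleFree D := by
  intro a b c P hP Q hQ R hR h₁ h₂ h₃ h₄ h₅ h₆
  have hmem : ∀ i, ![P, Q, R] i ∈ D := by
    intro i
    fin_cases i <;> simpa
  have hab : Majority ![P, Q, R] a b := majority_of_two (i := 0) (j := 2) (by decide) h₁ h₆
  have hbc : Majority ![P, Q, R] b c := majority_of_two (i := 0) (j := 1) (by decide) h₂ h₃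
  have hca : Majority ![P, Q, R] c a := majority_of_two (i := 1) (j := 2) (by decide) h₄ h₅
  exact lt_asymm hca (hD 3 (by decide) _ hmem a b c hab hbc)

theorem isCondorcetDomain_iff_isCycleFree {n : ℕ} {D : Finset (Pref n)} :
    IsCondorcetDomain D ↔ IsCycleFree D :=
  ⟨fun h => h.isCycleFree, fun h => h.isCondorcetDomain⟩

lemma IsCondorcetDomain.card_le_f {n : ℕ} {D : Finset (Pref n)} (hD : IsCondorcetDomain D) :
    D.card ≤ f n := by
  classical
  unfold f
  exact Finset.le_sup (f := Finset.card) (by simpa using hD)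

lemma exists_card_eq_f (n : ℕ) : ∃ D : Finset (Pref n), IsCondorcetDomain D ∧ D.card = f n := by
  classical
  obtain ⟨D, hD, h⟩ := Finset.exists_mem_eq_sup
    (Finset.univ.filter fun D : Finset (Pref n) => IsCondorcetDomain D)
    ⟨∅, by
      simp only [Finset.mem_filter, Finset.mem_univ, true_and,
        isCondorcetDomain_iff_isCycleFree]
      intro a b c P hP
      simp at hP⟩ Finset.card
  refine ⟨D, by simpa using hD, ?_⟩
  unfold f
  rw [← h]

lemma one_le_f (n : ℕ) : 1 ≤ f n := by
  have h : IsCycleFree ({1} : Finset (Pref n)) := by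
    intro a b c P hP Q hQ R hR h₁ h₂ h₃ h₄ _ _
    simp only [Finset.mem_singleton] at hP hQ
    subst hP hQ
    simp only [Prefers] at h₁ h₂ h₄
    exact lt_asymm (h₁.trans h₂) h₄
  simpa using h.isCondorcetDomain.card_le_f

lemma pref_ext {n : ℕ} {P Q : Pref n} (h : ∀ a b, P a < P b ↔ Q a < Q b) : P = Q := by
  have hm : StrictMono (P.symm.trans Q) := by
    intro a b hab
    simpa [← h] using hab
  have : (P.symm.trans Q : Fin n → Fin n) = id :=
    (hm.range_inj strictMono_id).1 (by simp only [(P.symm.trans Q).surjective.range_eq, Set.range_id])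
  ext x
  have := congrFun this (P x)
  simp at this
  rw [this]

/-! ### Substitution of a domain for an alternative -/

section Substitution

variable {n m : ℕ}

/-- The alternative of `Fin (n + 1)` to which an alternative of `Fin (n + m + 1)` collapses when
the last `m + 1` alternatives are identified. -/
def outer (n m : ℕ) (x : Fin (n + m + 1)) : Fin (n + 1) := ⟨min x n, by omega⟩

/-- The alternative of the substituted block `Fin (m + 1)` that corresponds to `x`. -/
def inner (n m : ℕ) (x : Fin (n + m + 1)) : Fin (m + 1) := ⟨x - n, by omega⟩

/-- The position of `x` in the order `P` with its last alternative replaced by the order `Q`. -/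
def substPos (P : Pref (n + 1)) (Q : Pref (m + 1)) (x : Fin (n + m + 1)) : Fin (n + m + 1) :=
  ⟨(P (outer n m x) : ℕ) + (if P (Fin.last n) < P (outer n m x) then m else 0) +
      (if (x : ℕ) < n then 0 else (Q (inner n m x) : ℕ)), by
    have h1 := (P (outer n m x)).2
    have h2 := (Q (inner n m x)).2
    have h3 := (P (Fin.last n)).2
    by_cases hx : (x : ℕ) < n
    · simp only [hx, if_true]
      split_ifs <;> omega
    · have : outer n m x = Fin.last n := by
        ext; simp only [outer, Fin.val_last]; omega
      simp only [this, lt_irrefl, if_false, hx]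
      omega⟩

lemma outer_eq_last_iff (x : Fin (n + m + 1)) : outer n m x = Fin.last n ↔ n ≤ (x : ℕ) := by
  rw [Fin.ext_iff]; simp [outer]

lemma outer_eq_outer_iff (x y : Fin (n + m + 1)) :
    outer n m x = outer n m y ↔ x = y ∨ (n ≤ (x : ℕ) ∧ n ≤ (y : ℕ)) := by
  rw [Fin.ext_iff, Fin.ext_iff]; simp only [outer]; omega

lemma substPos_lt_iff (P : Pref (n + 1)) (Q : Pref (m + 1)) (x y : Fin (n + m + 1)) :
    substPos P Q x < substPos P Q y ↔
      P (outer n m x) < P (outer n m y) ∨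
        (outer n m x = outer n m y ∧ Q (inner n m x) < Q (inner n m y)) := by
  have hx := (Q (inner n m x)).2
  have hy := (Q (inner n m y)).2
  have key : ∀ z, (z : Fin (n + m + 1)).val < n → P (outer n m z) ≠ P (Fin.last n) := by
    intro z hz h
    have := (outer_eq_last_iff z).1 (P.injective h)
    omega
  have hlast : ∀ z : Fin (n + m + 1), ¬ z.val < n → outer n m z = Fin.last n := by
    intro z hz
    exact (outer_eq_last_iff z).2 (by omega)
  rw [Fin.lt_def]
  simp only [substPos]
  by_cases h1 : (x : ℕ) < n <;> by_cases h2 : (y : ℕ) < n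
  · simp only [h1, h2, if_true]
    have h3 : outer n m x = outer n m y ∧ Q (inner n m x) < Q (inner n m y) ↔ False := by
      rw [outer_eq_outer_iff]
      constructor
      · rintro ⟨rfl | h, h'⟩
        · exact lt_irrefl _ h'
        · omega
      · exact False.elim
    rw [h3, or_false]
    simp only [Fin.lt_def]
    split_ifs <;> omega
  · have h4 := key x h1
    have h3 : outer n m x ≠ Fin.last n := fun h => h4 (by rw [h])
    simp only [h1, h2, hlast y h2, if_true, if_false, lt_irrefl, h3, false_and, or_false]
    rw [ne_eq, Fin.ext_iff] at h4
    simp only [Fin.lt_def]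
    split_ifs <;> omega
  · have h4 := key y h2
    have h3 : Fin.last n ≠ outer n m y := fun h => h4 (by rw [h])
    simp only [h1, h2, hlast x h1, if_true, if_false, lt_irrefl, h3, false_and, or_false]
    rw [ne_eq, Fin.ext_iff] at h4
    simp only [Fin.lt_def]
    split_ifs <;> omega
  · simp only [h1, h2, hlast x h1, hlast y h2, if_false, lt_irrefl, true_and, false_or]
    rw [Fin.lt_def]
    omega

lemma eq_of_outer_eq_of_inner_eq {x y : Fin (n + m + 1)} (h₁ : outer n m x = outer n m y)
    (h₂ : inner n m x = inner n m y) : x = y := by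
  rw [Fin.ext_iff] at h₁ h₂ ⊢
  simp only [outer, inner] at h₁ h₂
  omega

lemma substPos_injective (P : Pref (n + 1)) (Q : Pref (m + 1)) :
    Function.Injective (substPos P Q) := by
  intro x y h
  have h1 := substPos_lt_iff P Q x y
  have h2 := substPos_lt_iff P Q y x
  rw [h] at h1 h2
  simp only [lt_irrefl, false_iff, not_or, not_and, not_lt] at h1 h2
  have e : outer n m x = outer n m y := P.injective (le_antisymm h2.1 h1.1)
  exact eq_of_outer_eq_of_inner_eq e (Q.injective (le_antisymm (h2.2 e.symm) (h1.2 e)))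

/-- The order `P` with its last alternative replaced by the order `Q`. -/
noncomputable def subst (P : Pref (n + 1)) (Q : Pref (m + 1)) : Pref (n + m + 1) :=
  Equiv.ofBijective (substPos P Q) (Finite.injective_iff_bijective.1 (substPos_injective P Q))

lemma subst_lt_iff (P : Pref (n + 1)) (Q : Pref (m + 1)) (x y : Fin (n + m + 1)) :
    subst P Q x < subst P Q y ↔
      P (outer n m x) < P (outer n m y) ∨
        (outer n m x = outer n m y ∧ Q (inner n m x) < Q (inner n m y)) :=
  substPos_lt_iff P Q x y

/-- `P` is read off on the alternatives `0, …, n`, where `n` stands for the block, and `Q` on the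
block `n, …, n + m`. -/
lemma subst_injective {P P' : Pref (n + 1)} {Q Q' : Pref (m + 1)} (h : subst P Q = subst P' Q') :
    P = P' ∧ Q = Q' := by
  constructor
  · refine pref_ext fun a b => ?_
    have ho : ∀ a : Fin (n + 1), outer n m ⟨a, by omega⟩ = a := by
      intro a; ext; simp only [outer]; omega
    have hi : ∀ a : Fin (n + 1), inner n m ⟨a, by omega⟩ = 0 := by
      intro a; ext; simp only [inner, Fin.val_zero]; omega
    have h1 := subst_lt_iff P Q ⟨a, by omega⟩ ⟨b, by omega⟩
    rw [h, subst_lt_iff] at h1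
    simpa [ho, hi] using h1.symm
  · refine pref_ext fun a b => ?_
    have ho : ∀ a : Fin (m + 1), outer n m ⟨n + a, by omega⟩ = Fin.last n := by
      intro a; ext; simp only [outer, Fin.val_last]; omega
    have hi : ∀ a : Fin (m + 1), inner n m ⟨n + a, by omega⟩ = a := by
      intro a; ext; simp only [inner]; omega
    have h1 := subst_lt_iff P Q ⟨n + a, by omega⟩ ⟨n + b, by omega⟩
    rw [h, subst_lt_iff] at h1
    simpa [ho, hi] using h1.symm

/-- All orders of `D` with the last alternative replaced by an order of `E`. -/
noncomputable def substDomain (D : Finset (Pref (n + 1))) (E : Finset (Pref (m + 1))) :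
    Finset (Pref (n + m + 1)) := by
  classical exact (D ×ˢ E).image fun p => subst p.1 p.2

lemma card_substDomain (D : Finset (Pref (n + 1))) (E : Finset (Pref (m + 1))) :
    (substDomain D E).card = D.card * E.card := by
  classical
  rw [substDomain, Finset.card_image_of_injective, Finset.card_product]
  intro p q h
  exact Prod.ext_iff.2 (subst_injective h)

/-- If two alternatives of a cyclic triple lie in the block, some order of the cycle places the
third weakly between them, so it lies in the block too. Hence the cycle lives entirely in `E`, or
its alternatives collapse to distinct ones and it lives in `D`. -/
lemma IsCycleFree.substDomain {D : Finset (Pref (n + 1))} {E : Finset (Pref (m + 1))}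
    (hD : IsCycleFree D) (hE : IsCycleFree E) : IsCycleFree (substDomain D E) := by
  classical
  intro a b c _ hP _ hQ _ hR
  simp only [CondorcetDomain.substDomain, Finset.mem_image, Finset.mem_product,
    Prod.exists] at hP hQ hR
  obtain ⟨P, P', ⟨hP, hP'⟩, rfl⟩ := hP
  obtain ⟨Q, Q', ⟨hQ, hQ'⟩, rfl⟩ := hQ
  obtain ⟨R, R', ⟨hR, hR'⟩, rfl⟩ := hR
  simp only [Prefers, subst_lt_iff]
  intro h₁ h₂ h₃ h₄ h₅ h₆
  have weak : ∀ {S : Pref (n + 1)} {S' : Pref (m + 1)} {x y : Fin (n + m + 1)},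
      S (outer n m x) < S (outer n m y) ∨
        (outer n m x = outer n m y ∧ S' (inner n m x) < S' (inner n m y)) →
      S (outer n m x) ≤ S (outer n m y) := by
    rintro S S' x y (h | ⟨h, -⟩)
    · exact h.le
    · rw [h]
  have hab : outer n m a = outer n m b → outer n m b = outer n m c := fun h =>
    Q.injective (le_antisymm (weak h₃) (by rw [← h]; exact weak h₄))
  have hbc : outer n m b = outer n m c → outer n m c = outer n m a := fun h =>
    R.injective (le_antisymm (weak h₅) (by rw [← h]; exact weak h₆))
  have hca : outer n m c = outer n m a → outer n m a = outer n m b := fun h =>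
    P.injective (le_antisymm (weak h₁) (by rw [← h]; exact weak h₂))
  by_cases h : outer n m a = outer n m b
  · have e₂ := hab h
    have e₃ := hbc e₂
    simp only [h, ← e₂, lt_irrefl, true_and, false_or] at h₁ h₂ h₃ h₄ h₅ h₆
    exact hE _ _ _ _ hP' _ hQ' _ hR' h₁ h₂ h₃ h₄ h₅ h₆
  · have e₃ : outer n m c ≠ outer n m a := fun e => h (hca e)
    have e₂ : outer n m b ≠ outer n m c := fun e => e₃ (hbc e)
    simp only [h, e₂, e₃, false_and, or_false] at h₁ h₂ h₃ h₄ h₅ h₆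
    exact hD _ _ _ _ hP _ hQ _ hR h₁ h₂ h₃ h₄ h₅ h₆

end Substitution

theorem f_mul_f_le (n m : ℕ) : f (n + 1) * f (m + 1) ≤ f (n + m + 1) := by
  obtain ⟨D, hD, hDf⟩ := exists_card_eq_f (n + 1)
  obtain ⟨E, hE, hEf⟩ := exists_card_eq_f (m + 1)
  rw [← hDf, ← hEf, ← card_substDomain]
  exact (hD.isCycleFree.substDomain hE.isCycleFree).isCondorcetDomain.card_le_f

/-! ### Exponential upper bound -/

section Restriction

variable {n : ℕ}

/-- The order induced by `P` on the alternatives different from `x`. -/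
def restrict (P : Pref (n + 1)) (x : Fin (n + 1)) : Pref n :=
  (finSuccAboveEquiv x).trans
    ((P.subtypeEquiv fun a => by simp : {a // a ≠ x} ≃ {a // a ≠ P x}).trans
      (finSuccAboveEquiv (P x)).symm)

lemma succAbove_restrict (P : Pref (n + 1)) (x : Fin (n + 1)) (y : Fin n) :
    (P x).succAbove (restrict P x y) = P (x.succAbove y) := by
  have h : finSuccAboveEquiv (P x) (restrict P x y) =
      (P.subtypeEquiv fun a => by simp : {a // a ≠ x} ≃ {a // a ≠ P x})
        (finSuccAboveEquiv x y) := by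
    simp [restrict]
  simpa [finSuccAboveEquiv_apply] using congrArg Subtype.val h

lemma restrict_lt_restrict_iff (P : Pref (n + 1)) (x : Fin (n + 1)) (y z : Fin n) :
    restrict P x y < restrict P x z ↔ P (x.succAbove y) < P (x.succAbove z) := by
  rw [← succAbove_restrict, ← succAbove_restrict, Fin.succAbove_lt_succAbove_iff]

lemma eq_of_restrict_eq {P Q : Pref (n + 1)} {x : Fin (n + 1)}
    (h : restrict P x = restrict Q x) (hx : P x = Q x) : P = Q := by
  refine Equiv.ext fun a => ?_
  rcases eq_or_ne a x with rfl | ha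
  · exact hx
  · obtain ⟨y, rfl⟩ := Fin.exists_succAbove_eq ha
    rw [← succAbove_restrict, ← succAbove_restrict, h, hx]

lemma lt_iff_of_restrict_eq {P Q : Pref (n + 1)} {x y z : Fin (n + 1)}
    (h : restrict P x = restrict Q x) (hy : y ≠ x) (hz : z ≠ x) : P y < P z ↔ Q y < Q z := by
  obtain ⟨y, rfl⟩ := Fin.exists_succAbove_eq hy
  obtain ⟨z, rfl⟩ := Fin.exists_succAbove_eq hz
  rw [← restrict_lt_restrict_iff, h, restrict_lt_restrict_iff]

/-- Taking out `x` from above `y` lifts `y` by one position; reinserting `x` at or below the old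
position of `y` then leaves `y` above `x`. -/
lemma lt_of_restrict_eq_of_le {P Q : Pref (n + 1)} {x y : Fin (n + 1)}
    (h : restrict P x = restrict Q x) (hy : P x < P y) (hQ : P y ≤ Q x) : Q y < Q x := by
  obtain ⟨y, rfl⟩ := Fin.exists_succAbove_eq (show y ≠ x by rintro rfl; exact lt_irrefl _ hy)
  rw [← succAbove_restrict] at hy hQ ⊢
  rw [← h]
  rw [Fin.lt_succAbove_iff_le_castSucc] at hy
  rw [Fin.succAbove_of_le_castSucc _ _ hy] at hQ
  rw [Fin.succAbove_lt_iff_castSucc_lt]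
  exact lt_of_lt_of_le (Fin.castSucc_lt_succ) hQ

lemma lt_of_restrict_eq_of_ge {P Q : Pref (n + 1)} {x y : Fin (n + 1)}
    (h : restrict P x = restrict Q x) (hy : P y < P x) (hQ : Q x ≤ P y) : Q x < Q y := by
  obtain ⟨y, rfl⟩ := Fin.exists_succAbove_eq (show y ≠ x by rintro rfl; exact lt_irrefl _ hy)
  rw [← succAbove_restrict] at hy hQ ⊢
  rw [← h]
  rw [Fin.succAbove_lt_iff_castSucc_lt] at hy
  rw [Fin.succAbove_of_castSucc_lt _ _ hy] at hQ
  rw [Fin.lt_succAbove_iff_le_castSucc]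
  exact hQ

/-- The domain induced by `D` on the alternatives different from `x`. -/
def restrictDomain (D : Finset (Pref (n + 1))) (x : Fin (n + 1)) : Finset (Pref n) :=
  D.image fun P => restrict P x

lemma IsCycleFree.restrictDomain {D : Finset (Pref (n + 1))} (hD : IsCycleFree D)
    (x : Fin (n + 1)) : IsCycleFree (restrictDomain D x) := by
  intro a b c _ hP _ hQ _ hR
  simp only [CondorcetDomain.restrictDomain, Finset.mem_image] at hP hQ hR
  obtain ⟨P, hP, rfl⟩ := hP
  obtain ⟨Q, hQ, rfl⟩ := hQ
  obtain ⟨R, hR, rfl⟩ := hR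
  simp only [Prefers, restrict_lt_restrict_iff]
  exact hD _ _ _ P hP Q hQ R hR

end Restriction

/-- In each fibre of `ρ`, only the elements with the two largest keys have fewer than two elements
above them. -/
lemma card_filter_card_lt_two_le {α β κ : Type*} [DecidableEq α] [DecidableEq β] [LinearOrder κ]
    (s : Finset α) (ρ : α → β) (key : α → κ)
    (hinj : ∀ a ∈ s, ∀ b ∈ s, ρ a = ρ b → key a = key b → a = b) :
    (s.filter fun a => (s.filter fun b => ρ a = ρ b ∧ key a < key b).card < 2).card ≤
      2 * (s.image ρ).card := by
  refine Finset.card_le_mul_card_image_of_maps_to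
    (fun a ha => Finset.mem_image_of_mem ρ (Finset.mem_filter.1 ha).1) 2 fun r _ => ?_
  by_contra! h
  set T := {a ∈ s.filter fun a => (s.filter fun b => ρ a = ρ b ∧ key a < key b).card < 2 | ρ a = r}
    with hT
  obtain ⟨a, haT, ha⟩ := T.exists_min_image key (Finset.card_pos.1 (by omega))
  have haT' := haT
  simp only [hT, Finset.mem_filter] at haT'
  have hsub : T.erase a ⊆ s.filter fun b => ρ a = ρ b ∧ key a < key b := by
    intro b hb
    obtain ⟨hba, hbT⟩ := Finset.mem_erase.1 hb
    have hle := ha b hbT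
    simp only [hT, Finset.mem_filter] at hbT
    have hρ : ρ a = ρ b := haT'.2.trans hbT.2.symm
    refine Finset.mem_filter.2 ⟨hbT.1.1, hρ, lt_of_le_of_ne hle fun e => hba ?_⟩
    exact (hinj a haT'.1.1 b hbT.1.1 hρ e).symm
  have h1 := Finset.card_le_card hsub
  rw [Finset.card_erase_of_mem haT] at h1
  have := haT'.1.2
  omega

section Moves

variable {n : ℕ}

/-- The orders of `D` that arise from `P` by moving `x` down. -/
def movesDown (D : Finset (Pref (n + 1))) (P : Pref (n + 1)) (x : Fin (n + 1)) :
    Finset (Pref (n + 1)) :=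
  D.filter fun Q => restrict P x = restrict Q x ∧ P x < Q x

/-- The orders of `D` that arise from `P` by moving `x` up. -/
def movesUp (D : Finset (Pref (n + 1))) (P : Pref (n + 1)) (x : Fin (n + 1)) :
    Finset (Pref (n + 1)) :=
  D.filter fun Q => restrict P x = restrict Q x ∧ Q x < P x

lemma card_restrictDomain_le {D : Finset (Pref (n + 1))} (hD : IsCycleFree D) (x : Fin (n + 1)) :
    (restrictDomain D x).card ≤ f n :=
  (hD.restrictDomain x).isCondorcetDomain.card_le_f

lemma card_filter_movesDown_le {D : Finset (Pref (n + 1))} (hD : IsCycleFree D)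
    (x : Fin (n + 1)) : (D.filter fun P => (movesDown D P x).card < 2).card ≤ 2 * f n :=
  (card_filter_card_lt_two_le D (fun P => restrict P x) (fun P => P x)
    fun _ _ _ _ => eq_of_restrict_eq).trans
      (Nat.mul_le_mul_left 2 (card_restrictDomain_le hD x))

lemma card_filter_movesUp_le {D : Finset (Pref (n + 1))} (hD : IsCycleFree D)
    (x : Fin (n + 1)) : (D.filter fun P => (movesUp D P x).card < 2).card ≤ 2 * f n :=
  (card_filter_card_lt_two_le D (fun P => restrict P x) (fun P => OrderDual.toDual (P x))
    fun _ _ _ _ => eq_of_restrict_eq).trans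
      (Nat.mul_le_mul_left 2 (card_restrictDomain_le hD x))

/-- Two different moves of `x` end at two different lower positions, and only one of these can be
adjacent. -/
lemma exists_of_two_le_card_movesDown {D : Finset (Pref (n + 1))} {P : Pref (n + 1)}
    {x : Fin (n + 1)} (h : 2 ≤ (movesDown D P x).card) :
    ∃ Q ∈ D, restrict P x = restrict Q x ∧ (P x : ℕ) + 2 ≤ Q x := by
  by_contra! hc
  have : (movesDown D P x).card ≤ 1 := by
    refine Finset.card_le_one.2 fun Q hQ R hR => ?_
    simp only [movesDown, Finset.mem_filter] at hQ hR
    have h1 := hc Q hQ.1 hQ.2.1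
    have h2 := hc R hR.1 hR.2.1
    refine eq_of_restrict_eq (hQ.2.1.symm.trans hR.2.1) (Fin.ext ?_)
    have h3 := Fin.lt_def.1 hQ.2.2
    have h4 := Fin.lt_def.1 hR.2.2
    omega
  omega

lemma exists_of_two_le_card_movesUp {D : Finset (Pref (n + 1))} {P : Pref (n + 1)}
    {x : Fin (n + 1)} (h : 2 ≤ (movesUp D P x).card) :
    ∃ Q ∈ D, restrict P x = restrict Q x ∧ (Q x : ℕ) + 2 ≤ P x := by
  by_contra! hc
  have : (movesUp D P x).card ≤ 1 := by
    refine Finset.card_le_one.2 fun Q hQ R hR => ?_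
    simp only [movesUp, Finset.mem_filter] at hQ hR
    have h1 := hc Q hQ.1 hQ.2.1
    have h2 := hc R hR.1 hR.2.1
    refine eq_of_restrict_eq (hQ.2.1.symm.trans hR.2.1) (Fin.ext ?_)
    have h3 := Fin.lt_def.1 hQ.2.2
    have h4 := Fin.lt_def.1 hR.2.2
    omega
  omega

/-- Of three consecutive alternatives, either the first has fewer than two moves down or the last
has fewer than two moves up. -/
lemma movesDown_or_movesUp_lt_two {D : Finset (Pref (n + 1))} (hD : IsCycleFree D)
    {P : Pref (n + 1)} (hP : P ∈ D) {a b c : Fin (n + 1)} (hab : (P b : ℕ) = P a + 1)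
    (hbc : (P c : ℕ) = P b + 1) : (movesDown D P a).card < 2 ∨ (movesUp D P c).card < 2 := by
  by_contra! h
  obtain ⟨Q, hQ, hQa, hQ2⟩ := exists_of_two_le_card_movesDown h.1
  obtain ⟨R, hR, hRc, hR2⟩ := exists_of_two_le_card_movesUp h.2
  have h1 : P a < P b := by rw [Fin.lt_def]; omega
  have h2 : P b < P c := by rw [Fin.lt_def]; omega
  have hba : b ≠ a := by rintro rfl; exact lt_irrefl _ h1
  have hcb : c ≠ b := by rintro rfl; exact lt_irrefl _ h2
  have hca : c ≠ a := by rintro rfl; exact lt_asymm h1 h2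
  -- `P` ranks `abc`; moving `a` down two places gives `bca` in `Q`, and moving `c` up two places
  -- gives `cab` in `R`.
  refine hD a b c P hP Q hQ R hR h1 h2 ?_ ?_ ?_ ?_
  · exact (lt_iff_of_restrict_eq hQa hba hca).1 h2
  · exact lt_of_restrict_eq_of_le hQa (h1.trans h2) (by rw [Fin.le_def]; omega)
  · exact lt_of_restrict_eq_of_ge hRc (h1.trans h2) (by rw [Fin.le_def]; omega)
  · exact (lt_iff_of_restrict_eq hRc hca.symm hcb.symm).1 h1

end Moves

/-- There are `k + 1` windows of three consecutive positions, and an alternative is the top of at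
most one window and the bottom of at most one. -/
lemma le_card_filter_moves {k : ℕ} {D : Finset (Pref (k + 3))} (hD : IsCycleFree D)
    {P : Pref (k + 3)} (hP : P ∈ D) :
    k + 1 ≤ (Finset.univ.filter fun x => (movesDown D P x).card < 2).card +
      (Finset.univ.filter fun x => (movesUp D P x).card < 2).card := by
  classical
  let lo : Fin (k + 1) → Fin (k + 3) := fun i => P.symm ⟨i, by omega⟩
  let hi : Fin (k + 1) → Fin (k + 3) := fun i => P.symm ⟨i + 2, by omega⟩
  have hlo : Function.Injective lo := by
    intro i j h
    have := P.symm.injective h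
    rw [Fin.mk.injEq] at this
    exact Fin.ext this
  have hhi : Function.Injective hi := by
    intro i j h
    have := P.symm.injective h
    rw [Fin.mk.injEq] at this
    exact Fin.ext (by omega)
  have hcover : (Finset.univ : Finset (Fin (k + 1))) ⊆
      (Finset.univ.filter fun i => (movesDown D P (lo i)).card < 2) ∪
        Finset.univ.filter fun i => (movesUp D P (hi i)).card < 2 := by
    intro i _
    have := movesDown_or_movesUp_lt_two hD hP (a := lo i) (b := P.symm ⟨i + 1, by omega⟩)
      (c := hi i) (by simp [lo]) (by simp [hi])
    simpa using this
  have h1 := (Finset.card_le_card hcover).trans (Finset.card_union_le _ _)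
  rw [Finset.card_univ, Fintype.card_fin] at h1
  refine h1.trans (Nat.add_le_add ?_ ?_)
  · exact Finset.card_le_card_of_injOn lo (fun i hi => by simpa using hi) hlo.injOn
  · exact Finset.card_le_card_of_injOn hi (fun i hi => by simpa using hi) hhi.injOn

/-- Double counting: every order has at least `k + 1` immobile alternatives, counted with direction,
while each alternative is immobile in each direction for at most `2 * f (k + 2)` orders. -/
lemma mul_f_le (k : ℕ) : (k + 1) * f (k + 3) ≤ 4 * (k + 3) * f (k + 2) := by
  obtain ⟨D, hD, hDf⟩ := exists_card_eq_f (k + 3)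
  have hD := hD.isCycleFree
  have hswap : ∀ p : Pref (k + 3) → Fin (k + 3) → Prop, ∀ [∀ P x, Decidable (p P x)],
      (∀ x, (D.filter fun P => p P x).card ≤ 2 * f (k + 2)) →
        ∑ P ∈ D, (Finset.univ.filter fun x => p P x).card ≤ (k + 3) * (2 * f (k + 2)) := by
    intro p _ h
    simp only [Finset.card_filter] at h ⊢
    rw [Finset.sum_comm]
    refine (Finset.sum_le_card_nsmul _ _ _ fun x _ => h x).trans ?_
    simp
  calc (k + 1) * f (k + 3) = ∑ P ∈ D, (k + 1) := by
        rw [Finset.sum_const, smul_eq_mul, hDf, mul_comm]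
    _ ≤ ∑ P ∈ D, ((Finset.univ.filter fun x => (movesDown D P x).card < 2).card +
          (Finset.univ.filter fun x => (movesUp D P x).card < 2).card) :=
        Finset.sum_le_sum fun P hP => le_card_filter_moves hD hP
    _ ≤ (k + 3) * (2 * f (k + 2)) + (k + 3) * (2 * f (k + 2)) := by
        rw [Finset.sum_add_distrib]
        exact Nat.add_le_add (hswap _ (card_filter_movesDown_le hD))
          (hswap _ (card_filter_movesUp_le hD))
    _ = 4 * (k + 3) * f (k + 2) := by ring

lemma f_succ_le (k : ℕ) : f (k + 3) ≤ 12 * f (k + 2) := by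
  have h := mul_f_le k
  have h2 : 4 * (k + 3) * f (k + 2) ≤ (k + 1) * (12 * f (k + 2)) := by
    have : 4 * (k + 3) ≤ (k + 1) * 12 := by omega
    calc 4 * (k + 3) * f (k + 2) ≤ (k + 1) * 12 * f (k + 2) := Nat.mul_le_mul_right _ this
      _ = _ := by ring
  exact Nat.le_of_mul_le_mul_left (h.trans h2) (Nat.succ_pos k)

theorem f_le (k : ℕ) : f (k + 2) ≤ f 2 * 12 ^ k := by
  induction k with
  | zero => simp
  | succ k ih =>
    calc f (k + 3) ≤ 12 * f (k + 2) := f_succ_le k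
      _ ≤ 12 * (f 2 * 12 ^ k) := Nat.mul_le_mul_left _ ih
      _ = f 2 * 12 ^ (k + 1) := by ring

/-! ### Domains from set families of small VC dimension -/

section Family

variable {n : ℕ}

/-- The orders all of whose upper sets of positions belong to the set family `𝒜`. -/
def domainOf (𝒜 : Finset (Finset (Fin n))) : Finset (Pref n) :=
  Finset.univ.filter fun P => ∀ k ≤ n, (Finset.univ.filter fun x => k ≤ (P x : ℕ)) ∈ 𝒜

/-- The upper sets of `abc`, `bca` and `cab` together cut out all eight subsets of the triple, so a
cyclic triple would be shattered. -/
lemma isCycleFree_domainOf {𝒜 : Finset (Finset (Fin n))}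
    (h : ∀ s : Finset (Fin n), s.card = 3 → ¬ 𝒜.Shatters s) : IsCycleFree (domainOf 𝒜) := by
  intro a b c P hP Q hQ R hR h₁ h₂ h₃ h₄ h₅ h₆
  simp only [domainOf, Finset.mem_filter, Finset.mem_univ, true_and] at hP hQ hR
  simp only [Prefers] at h₁ h₂ h₃ h₄ h₅ h₆
  have hab : a ≠ b := by rintro rfl; exact lt_irrefl _ h₁
  have hbc : b ≠ c := by rintro rfl; exact lt_irrefl _ h₂
  have hac : a ≠ c := by rintro rfl; exact lt_asymm h₁ h₂
  refine h {a, b, c} (Finset.card_eq_three.2 ⟨a, b, c, hab, hac, hbc, rfl⟩) fun t ht => ?_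
  have htr : ∀ S ∈ ({P, Q, R} : Finset (Pref n)), ∀ k ≤ n,
      (∀ x ∈ ({a, b, c} : Finset (Fin n)), x ∈ t ↔ k ≤ (S x : ℕ)) →
      ∃ u ∈ 𝒜, {a, b, c} ∩ u = t := by
    intro S hS k hk hx
    refine ⟨Finset.univ.filter fun x => k ≤ (S x : ℕ), ?_, ?_⟩
    · simp only [Finset.mem_insert, Finset.mem_singleton] at hS
      rcases hS with rfl | rfl | rfl
      · exact hP k hk
      · exact hQ k hk
      · exact hR k hk
    · ext x
      rw [Finset.mem_inter, Finset.mem_filter]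
      constructor
      · rintro ⟨hxs, -, hxk⟩
        exact (hx x hxs).2 hxk
      · intro hxt
        exact ⟨ht hxt, Finset.mem_univ _, (hx x (ht hxt)).1 hxt⟩
  simp only [Finset.mem_insert, Finset.mem_singleton, forall_eq_or_imp, forall_eq] at htr
  obtain ⟨hP', hQ', hR'⟩ := htr
  rw [Fin.lt_def] at h₁ h₂ h₃ h₄ h₅ h₆
  by_cases ha : a ∈ t <;> by_cases hb : b ∈ t <;> by_cases hc : c ∈ t
  · exact hP' 0 (by omega) (by simp [ha, hb, hc])
  · exact hR' (R a) (by omega) ⟨by simp [ha], by simp [hb]; omega, by simp [hc]; omega⟩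
  · exact hQ' (Q c) (by omega) ⟨by simp [ha]; omega, by simp [hb]; omega, by simp [hc]⟩
  · exact hQ' (Q a) (by omega) ⟨by simp [ha], by simp [hb]; omega, by simp [hc]; omega⟩
  · exact hP' (P b) (by omega) ⟨by simp [ha]; omega, by simp [hb], by simp [hc]; omega⟩
  · exact hR' (R b) (by omega) ⟨by simp [ha]; omega, by simp [hb], by simp [hc]; omega⟩
  · exact hP' (P c) (by omega) ⟨by simp [ha]; omega, by simp [hb]; omega, by simp [hc]⟩
  · exact hP' n le_rfl (by simp [ha, hb, hc])

/-- There are at least `c` maximal chains from `∅` to `s` in the set family `𝒜`, each of them coded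
as the list of its added elements, the last one first. -/
def HasChains (𝒜 : Finset (Finset (Fin n))) (s : Finset (Fin n)) (c : ℕ) : Prop :=
  ∃ A : Finset (List (Fin n)), c ≤ A.card ∧
    ∀ w ∈ A, w.Nodup ∧ w.toFinset = s ∧ ∀ v, v <:+ w → v.toFinset ∈ 𝒜

lemma hasChains_zero (𝒜 : Finset (Finset (Fin n))) (s : Finset (Fin n)) : HasChains 𝒜 s 0 :=
  ⟨∅, by simp, by simp⟩

lemma HasChains.mono {𝒜 : Finset (Finset (Fin n))} {s : Finset (Fin n)} {c d : ℕ}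
    (h : HasChains 𝒜 s c) (hd : d ≤ c) : HasChains 𝒜 s d := by
  obtain ⟨A, hA, h⟩ := h
  exact ⟨A, hd.trans hA, h⟩

lemma hasChains_empty {𝒜 : Finset (Finset (Fin n))} (h : ∅ ∈ 𝒜) : HasChains 𝒜 ∅ 1 := by
  refine ⟨{[]}, by simp, ?_⟩
  intro w hw
  rw [Finset.mem_singleton] at hw
  subst hw
  refine ⟨List.nodup_nil, rfl, fun v hv => ?_⟩
  rw [List.suffix_nil] at hv
  subst hv
  simpa using h

/-- Chains to `s` are partitioned by the element added last, the head of the list. -/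
lemma hasChains_sum {𝒜 : Finset (Finset (Fin n))} {s : Finset (Fin n)} (hs : s ∈ 𝒜)
    {c : Fin n → ℕ} (h : ∀ x ∈ s, HasChains 𝒜 (s.erase x) (c x)) :
    HasChains 𝒜 s (∑ x ∈ s, c x) := by
  have h' : ∀ x, ∃ A : Finset (List (Fin n)), x ∈ s → c x ≤ A.card ∧
      ∀ w ∈ A, w.Nodup ∧ w.toFinset = s.erase x ∧ ∀ v, v <:+ w → v.toFinset ∈ 𝒜 := by
    intro x
    by_cases hx : x ∈ s
    · obtain ⟨A, hA⟩ := h x hx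
      exact ⟨A, fun _ => hA⟩
    · exact ⟨∅, fun hx' => absurd hx' hx⟩
  choose A hA using h'
  refine ⟨s.biUnion fun x => (A x).image (List.cons x), ?_, ?_⟩
  · rw [Finset.card_biUnion]
    · refine Finset.sum_le_sum fun x hx => ?_
      rw [Finset.card_image_of_injective _ List.cons_injective]
      exact (hA x hx).1
    · intro x _ y _ hxy
      refine Finset.disjoint_left.2 fun w hw hw' => hxy ?_
      simp only [Finset.mem_image] at hw hw'
      obtain ⟨v, -, rfl⟩ := hw
      obtain ⟨v', -, hv'⟩ := hw'
      exact (List.cons_eq_cons.1 hv').1.symm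
  · intro w hw
    simp only [Finset.mem_biUnion, Finset.mem_image] at hw
    obtain ⟨x, hx, v, hv, rfl⟩ := hw
    obtain ⟨hv1, hv2, hv3⟩ := (hA x hx).2 v hv
    have hxv : x ∉ v := by
      rw [← List.mem_toFinset, hv2]
      simp
    have htf : (x :: v).toFinset = s := by
      rw [List.toFinset_cons, hv2, Finset.insert_erase hx]
    refine ⟨List.nodup_cons.2 ⟨hxv, hv1⟩, htf, fun u hu => ?_⟩
    rcases List.suffix_cons_iff.1 hu with rfl | hu
    · rwa [htf]
    · exact hv3 u hu

/-- The order in which the alternatives occur in the list `w`. -/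
noncomputable def prefOfList (w : List (Fin n)) (hw : w.Nodup) (h : w.toFinset = Finset.univ) :
    Pref n :=
  Equiv.ofBijective
    (fun x => ⟨w.idxOf x, by
      have h1 := List.toFinset_card_of_nodup hw
      rw [h, Finset.card_univ, Fintype.card_fin] at h1
      have hx : x ∈ w := by rw [← List.mem_toFinset, h]; exact Finset.mem_univ x
      exact (List.idxOf_lt_length_of_mem hx).trans_eq h1.symm⟩)
    (Finite.injective_iff_bijective.1 fun x y hxy => by
      have hx : x ∈ w := by rw [← List.mem_toFinset, h]; exact Finset.mem_univ x
      exact (List.idxOf_inj hx).1 (congrArg Fin.val hxy))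

lemma prefOfList_apply (w : List (Fin n)) (hw : w.Nodup) (h : w.toFinset = Finset.univ)
    (x : Fin n) : (prefOfList w hw h x : ℕ) = w.idxOf x := rfl

lemma le_idxOf_iff_mem_drop {α : Type*} [DecidableEq α] {w : List α} (hw : w.Nodup) {x : α}
    (hx : x ∈ w) (k : ℕ) : k ≤ w.idxOf x ↔ x ∈ w.drop k := by
  have hlt := List.idxOf_lt_length_of_mem hx
  rw [List.mem_drop_iff_getElem]
  constructor
  · intro h
    refine ⟨w.idxOf x - k, by omega, ?_⟩
    have : k + (w.idxOf x - k) = w.idxOf x := by omega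
    simp [this]
  · rintro ⟨i, hi, rfl⟩
    rw [List.Nodup.idxOf_getElem hw]
    omega

/-- With positions given by list indices, the alternatives at position `k` or later form `w.drop k`,
a suffix of `w` and hence a member of the chain. -/
lemma HasChains.le_card_domainOf {𝒜 : Finset (Finset (Fin n))} {c : ℕ}
    (h : HasChains 𝒜 Finset.univ c) : c ≤ (domainOf 𝒜).card := by
  obtain ⟨A, hc, hA⟩ := h
  refine hc.trans ?_
  rw [← Finset.card_attach]
  refine Finset.card_le_card_of_injOn
    (fun w => prefOfList w.1 (hA w.1 w.2).1 (hA w.1 w.2).2.1) ?_ ?_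
  · rintro ⟨w, hw⟩ -
    obtain ⟨h1, h2, h3⟩ := hA w hw
    simp only [domainOf, Finset.coe_filter, Finset.mem_univ, true_and, Set.mem_ofPred_eq]
    intro k _
    have key : (Finset.univ.filter fun x => k ≤ (prefOfList w h1 h2 x : ℕ)) =
        (w.drop k).toFinset := by
      ext x
      have hx : x ∈ w := by rw [← List.mem_toFinset, h2]; exact Finset.mem_univ x
      rw [List.mem_toFinset, ← le_idxOf_iff_mem_drop h1 hx, Finset.mem_filter_univ,
        prefOfList_apply]
    rw [key]
    exact h3 _ (List.drop_suffix k w)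
  · rintro ⟨w, hw⟩ - ⟨w', hw'⟩ - heq
    obtain ⟨h1, h2, -⟩ := hA w hw
    obtain ⟨h1', h2', -⟩ := hA w' hw'
    have hidx : ∀ x, w.idxOf x = w'.idxOf x := fun x =>
      congrArg (fun P : Pref n => (P x : ℕ)) heq
    have hl : w.length = w'.length := by
      rw [← List.toFinset_card_of_nodup h1, ← List.toFinset_card_of_nodup h1', h2, h2']
    refine Subtype.ext (List.ext_getElem hl fun i hi hi' => ?_)
    have h4 := hidx w[i]
    rw [List.Nodup.idxOf_getElem h1] at h4
    have hx : w[i] ∈ w' := by rw [← List.mem_toFinset, h2']; exact Finset.mem_univ _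
    have h5 := List.getElem_idxOf (List.idxOf_lt_length_of_mem hx)
    simp only [← h4] at h5
    exact h5.symm

end Family

/-! ### Set families coded by bit masks -/

section Masks

/-- The set of the positions of the binary digits `1` of `m` below `n`. -/
def ofMask (n m : ℕ) : Finset (Fin n) := Finset.univ.filter fun x => m.testBit x

lemma mem_ofMask {n m : ℕ} {x : Fin n} : x ∈ ofMask n m ↔ m.testBit x := by simp [ofMask]

/-- The set family coded by the list `T` of bit masks. -/
def family (n : ℕ) (T : List ℕ) : Finset (Finset (Fin n)) :=
  (T.map (ofMask n)).toFinset

lemma mem_family {n : ℕ} {T : List ℕ} {s : Finset (Fin n)} :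
    s ∈ family n T ↔ ∃ m ∈ T, ofMask n m = s := by
  simp [family]

/-- The value of the key `k` in the table `T`, and `0` if there is none. -/
def lookupD (k : ℕ) : List (ℕ × ℕ) → ℕ
  | [] => 0
  | p :: T => bif Nat.beq k p.1 then p.2 else lookupD k T

lemma lookupD_eq_zero_or_mem (k : ℕ) (T : List (ℕ × ℕ)) :
    lookupD k T = 0 ∨ (k, lookupD k T) ∈ T := by
  induction T with
  | nil => exact Or.inl rfl
  | cons p T ih =>
    rw [lookupD]
    cases h : Nat.beq k p.1 with
    | true =>
      obtain rfl := Nat.eq_of_beq_eq_true h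
      exact Or.inr List.mem_cons_self
    | false => exact ih.imp id (List.mem_cons_of_mem _)

/-- The sum of the entries in the table `T` of the sets that arise from `ofMask n m` by the removal
of one element. -/
def sumBelow (n : ℕ) (T : List (ℕ × ℕ)) (m : ℕ) : ℕ :=
  ((List.range n).map fun x =>
    bif Nat.testBit m x then lookupD (Nat.xor m (Nat.pow 2 x)) T else 0).sum

/-- Every entry of each table is at most the sum of the entries in the preceding table of the sets
with one element less. -/
def checkCounts (n : ℕ) (T : List (ℕ × ℕ)) : List (List (ℕ × ℕ)) → Bool
  | [] => true
  | T' :: L => (T'.all fun p => Nat.ble p.2 (sumBelow n T p.1)) && checkCounts n T' L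

/-- The incidence vector of the element `x` with the sets coded by `T`. -/
def column (x : ℕ) : List ℕ → ℕ
  | [] => 0
  | u :: T => Nat.bit (Nat.testBit u x) (column x T)

/-- Of the three pairwise and three singleton traces on three elements with incidence vectors
`a`, `b`, `c`, at least one does not occur. -/
def missesTrace (a b c : ℕ) : Bool :=
  Nat.beq (Nat.land a (Nat.lor b c)) a || Nat.beq (Nat.land b (Nat.lor a c)) b ||
    Nat.beq (Nat.land c (Nat.lor a b)) c || Nat.beq (Nat.land (Nat.land a b) c) (Nat.land a b) ||
    Nat.beq (Nat.land (Nat.land a c) b) (Nat.land a c) ||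
    Nat.beq (Nat.land (Nat.land b c) a) (Nat.land b c)

/-- Every three of the incidence vectors in the list `C` miss a trace. -/
def checkTraces (C : List ℕ) : Bool :=
  (List.range C.length).all fun k => (List.range k).all fun j => (List.range j).all fun i =>
    missesTrace (C.getD i 0) (C.getD j 0) (C.getD k 0)

lemma ofMask_xor_two_pow {n m : ℕ} {x : Fin n} (h : m.testBit x) :
    ofMask n (m ^^^ 2 ^ (x : ℕ)) = (ofMask n m).erase x := by
  ext y
  rw [Finset.mem_erase, mem_ofMask, mem_ofMask, Nat.testBit_xor]
  rcases eq_or_ne y x with rfl | hy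
  · simp [h]
  · simp [Nat.testBit_two_pow_of_ne (fun e => hy (Fin.ext e).symm), hy]

lemma hasChains_sumBelow {n : ℕ} {𝒜 : Finset (Finset (Fin n))} {T : List (ℕ × ℕ)}
    (hT : ∀ p ∈ T, HasChains 𝒜 (ofMask n p.1) p.2) {m : ℕ} (hm : ofMask n m ∈ 𝒜) :
    HasChains 𝒜 (ofMask n m) (sumBelow n T m) := by
  have hsum : sumBelow n T m = ∑ x ∈ ofMask n m, lookupD (m ^^^ 2 ^ (x : ℕ)) T := by
    rw [ofMask, Finset.sum_filter, Fin.sum_univ_eq_sum_range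
      (fun x => if m.testBit x then lookupD (m ^^^ 2 ^ x) T else 0)]
    simp only [sumBelow, Bool.cond_eq_ite]
    rfl
  rw [hsum]
  refine hasChains_sum hm fun x hx => ?_
  rw [← ofMask_xor_two_pow (mem_ofMask.1 hx)]
  -- A set missing from the table counts as `0`, still a valid lower bound.
  rcases lookupD_eq_zero_or_mem (m ^^^ 2 ^ (x : ℕ)) T with h | h
  · rw [h]
    exact hasChains_zero _ _
  · exact hT _ h

lemma hasChains_of_checkCounts {n : ℕ} {𝒜 : Finset (Finset (Fin n))} (L : List (List (ℕ × ℕ))) :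
    ∀ T : List (ℕ × ℕ), (∀ p ∈ T, HasChains 𝒜 (ofMask n p.1) p.2) →
      (∀ p ∈ L.flatten, ofMask n p.1 ∈ 𝒜) → checkCounts n T L = true →
        ∀ p ∈ L.flatten, HasChains 𝒜 (ofMask n p.1) p.2 := by
  induction L with
  | nil => simp
  | cons T' L ih =>
    intro T hT hL hc p hp
    rw [checkCounts, Bool.and_eq_true, List.all_eq_true] at hc
    simp only [List.flatten_cons, List.mem_append] at hL hp
    have hT' : ∀ p ∈ T', HasChains 𝒜 (ofMask n p.1) p.2 := fun p hp =>
      (hasChains_sumBelow hT (hL p (Or.inl hp))).mono (Nat.le_of_ble_eq_true (hc.1 p hp))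
    rcases hp with hp | hp
    · exact hT' p hp
    · exact ih T' hT' (fun q hq => hL q (Or.inr hq)) hc.2 p hp

lemma exists_testBit_column {u : ℕ} {T : List ℕ} (hu : u ∈ T) :
    ∃ i, ∀ x, (column x T).testBit i = u.testBit x := by
  induction T with
  | nil => simp at hu
  | cons v T ih =>
    rcases List.mem_cons.1 hu with rfl | hu
    · exact ⟨0, fun x => Nat.testBit_bit_zero _ _⟩
    · obtain ⟨i, hi⟩ := ih hu
      exact ⟨i + 1, fun x => (Nat.testBit_bit_succ _ _ _).trans (hi x)⟩

/-- Each of the six tests says that one trace is absent. The empty and the full trace need no test: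
the families used contain the empty and the full set, so these traces always occur. -/
lemma missesTrace_eq_false {a b c : ℕ}
    (h : ∀ p q r : Bool, ∃ i, a.testBit i = p ∧ b.testBit i = q ∧ c.testBit i = r) :
    missesTrace a b c = false := by
  by_contra hc
  rw [Bool.not_eq_false] at hc
  have key : ∀ (e e' : ℕ) (i : ℕ), Nat.beq e e' = true → e.testBit i = e'.testBit i :=
    fun e e' i h => by rw [Nat.eq_of_beq_eq_true h]
  have hand : ∀ x y i : ℕ, (Nat.land x y).testBit i = (x.testBit i && y.testBit i) :=
    Nat.testBit_and
  have hor : ∀ x y i : ℕ, (Nat.lor x y).testBit i = (x.testBit i || y.testBit i) :=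
    Nat.testBit_or
  simp only [missesTrace, Bool.or_eq_true] at hc
  rcases hc with ((((hc | hc) | hc) | hc) | hc) | hc
  · obtain ⟨i, h1, h2, h3⟩ := h true false false
    simpa [hand, hor, h1, h2, h3] using key _ _ i hc
  · obtain ⟨i, h1, h2, h3⟩ := h false true false
    simpa [hand, hor, h1, h2, h3] using key _ _ i hc
  · obtain ⟨i, h1, h2, h3⟩ := h false false true
    simpa [hand, hor, h1, h2, h3] using key _ _ i hc
  · obtain ⟨i, h1, h2, h3⟩ := h true true false
    simpa [hand, hor, h1, h2, h3] using key _ _ i hc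
  · obtain ⟨i, h1, h2, h3⟩ := h true false true
    simpa [hand, hor, h1, h2, h3] using key _ _ i hc
  · obtain ⟨i, h1, h2, h3⟩ := h false true true
    simpa [hand, hor, h1, h2, h3] using key _ _ i hc

lemma missesTrace_column_eq_false {n : ℕ} {T : List ℕ} {a b c : Fin n} (hab : a ≠ b)
    (hac : a ≠ c) (hbc : b ≠ c) (h : (family n T).Shatters {a, b, c}) :
    missesTrace (column a T) (column b T) (column c T) = false := by
  refine missesTrace_eq_false fun p q r => ?_
  let t : Finset (Fin n) := Finset.univ.filter fun x =>
    (x = a ∧ p = true) ∨ (x = b ∧ q = true) ∨ (x = c ∧ r = true)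
  obtain ⟨u, hu, hut⟩ := h (t := t) (by
    intro x hx
    simp only [t, Finset.mem_filter_univ] at hx
    simp only [Finset.mem_insert, Finset.mem_singleton]
    tauto)
  obtain ⟨m, hm, rfl⟩ := mem_family.1 hu
  obtain ⟨i, hi⟩ := exists_testBit_column hm
  have ha := Finset.ext_iff.1 hut a
  have hb := Finset.ext_iff.1 hut b
  have hc := Finset.ext_iff.1 hut c
  simp only [t, Finset.mem_inter, Finset.mem_insert, Finset.mem_singleton, mem_ofMask,
    Finset.mem_filter_univ, hab, hac, hbc, hab.symm, hac.symm, hbc.symm, or_true,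
    true_and, false_and, or_false, false_or] at ha hb hc
  refine ⟨i, ?_, ?_, ?_⟩
  · rw [hi]; exact Bool.eq_iff_iff.2 ha
  · rw [hi]; exact Bool.eq_iff_iff.2 hb
  · rw [hi]; exact Bool.eq_iff_iff.2 hc

lemma not_shatters_of_checkTraces {n : ℕ} {T C : List ℕ}
    (hC : (List.range n).map (fun x => column x T) = C) (h : checkTraces C = true)
    (s : Finset (Fin n)) (hs : s.card = 3) : ¬ (family n T).Shatters s := by
  intro hsh
  -- The check runs only over increasing triples of indices, so the elements of `s` are listed in
  -- increasing order.
  have hab : s.orderEmbOfFin hs 0 < s.orderEmbOfFin hs 1 :=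
    (s.orderEmbOfFin hs).strictMono (by decide)
  have hbc : s.orderEmbOfFin hs 1 < s.orderEmbOfFin hs 2 :=
    (s.orderEmbOfFin hs).strictMono (by decide)
  have hsa : s = {s.orderEmbOfFin hs 0, s.orderEmbOfFin hs 1, s.orderEmbOfFin hs 2} := by
    ext x
    rw [← Finset.mem_coe, ← Finset.range_orderEmbOfFin s hs, Set.mem_range]
    simp only [Fin.exists_fin_succ, eq_comm (b := x)]
    simp
  generalize s.orderEmbOfFin hs 0 = a at *
  generalize s.orderEmbOfFin hs 1 = b at *
  generalize s.orderEmbOfFin hs 2 = c at *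
  rw [hsa] at hsh
  have hfalse := missesTrace_column_eq_false hab.ne (hab.trans hbc).ne hbc.ne hsh
  have hlen : C.length = n := by rw [← hC]; simp
  have hcol : ∀ x : Fin n, C.getD x 0 = column x T := by
    intro x
    subst hC
    simp [List.getD_eq_getElem?_getD]
  have h1 := List.all_eq_true.1 h c (List.mem_range.2 (by rw [hlen]; exact c.2))
  have h2 := List.all_eq_true.1 h1 b (List.mem_range.2 hbc)
  have h3 := List.all_eq_true.1 h2 a (List.mem_range.2 hab)
  rw [hcol, hcol, hcol, hfalse] at h3
  exact Bool.false_ne_true h3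

theorem le_f_of_check {n c : ℕ} {L : List (List (ℕ × ℕ))} {C : List ℕ}
    (h₁ : checkCounts n [(0, 1)] L = true)
    (h₂ : (List.range n).map (fun x => column x (0 :: L.flatten.map Prod.fst)) = C)
    (h₃ : checkTraces C = true) (h₄ : (2 ^ n - 1, c) ∈ L.flatten) : c ≤ f n := by
  set T := 0 :: L.flatten.map Prod.fst with hT
  have h0 : ofMask n 0 = ∅ := by simp [ofMask]
  have hbase : ∀ p ∈ [((0 : ℕ), 1)], HasChains (family n T) (ofMask n p.1) p.2 := by
    intro p hp
    rw [List.mem_singleton] at hp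
    subst hp
    rw [h0]
    exact hasChains_empty (mem_family.2 ⟨0, List.mem_cons_self, h0⟩)
  have h := hasChains_of_checkCounts L _ hbase (fun p hp => mem_family.2
    ⟨p.1, List.mem_cons_of_mem _ (List.mem_map_of_mem hp), rfl⟩) h₁ _ h₄
  have hu : ofMask n (2 ^ n - 1) = Finset.univ := by
    ext x
    simp [mem_ofMask, Nat.testBit_two_pow_sub_one]
  rw [hu] at h
  exact h.le_card_domainOf.trans
    (isCycleFree_domainOf (not_shatters_of_checkTraces h₂ h₃)).isCondorcetDomain.card_le_f

end Masks

/-! ### A domain on 18 alternatives -/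

/-- The nonempty members of a set family on 18 elements without shattered triples, coded as bit
masks and grouped by their cardinality. Each is listed with the number of maximal chains below
it. -/
def chainTable : List (List (ℕ × ℕ)) :=
  [[(1, 1), (2, 1), (4, 1), (32, 1), (64, 1)], [(3, 2), (6, 2), (33, 2), (96, 2)], [(7, 4),
    (14, 2), (35, 4), (97, 4), (224, 2)], [(15, 6), (30, 2), (39, 8), (99, 8), (105, 4),
    (135, 4), (225, 6), (480, 2)], [(31, 8), (47, 14), (103, 16), (107, 12), (121, 4), (167, 12),
    (227, 14), (391, 4), (481, 8), (8672, 2), (131552, 2)], [(63, 22), (111, 42), (123, 16),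
    (231, 42), (423, 16), (483, 22), (8223, 8), (8673, 10), (12768, 2), (131103, 8),
    (131553, 10), (197088, 2)], [(127, 80), (239, 84), (247, 42), (367, 42), (487, 80),
    (8255, 30), (8675, 32), (12319, 8), (12769, 12), (14816, 2), (131135, 30), (131555, 32),
    (196639, 8), (197089, 12), (229856, 2)], [(255, 206), (495, 206), (8319, 110), (8679, 112),
    (12351, 38), (12771, 44), (14367, 8), (14817, 14), (15840, 2), (131199, 110), (131559, 112),
    (196671, 38), (197091, 44), (229407, 8), (229857, 14), (246240, 2)], [(511, 412),
    (8447, 316), (8687, 318), (12415, 148), (12775, 156), (14399, 46), (14819, 58), (15391, 8),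
    (15841, 16), (16352, 2), (131327, 316), (131567, 318), (196735, 148), (197095, 156),
    (229439, 46), (229859, 58), (245791, 8), (246241, 16)], [(8703, 1046), (12543, 464),
    (12783, 474), (14463, 194), (14823, 214), (15423, 54), (15843, 74), (15903, 8), (16353, 18),
    (131583, 1046), (196863, 464), (197103, 474), (229503, 194), (229863, 214), (245823, 54),
    (246243, 74)], [(12799, 1984), (14591, 658), (14831, 688), (15487, 248), (15847, 288),
    (15935, 62), (16355, 92), (74239, 1046), (135679, 1046), (139775, 2092), (197119, 1984),
    (229631, 658), (229871, 688), (245887, 248), (246247, 288)], [(14847, 3330), (15615, 906),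
    (15855, 976), (15999, 310), (16359, 380), (45567, 1984), (143871, 5122), (199167, 1984),
    (205311, 5122), (229887, 3330), (246015, 906), (246255, 976)], [(15871, 5212), (16127, 1216),
    (16367, 1356), (61951, 1984), (145919, 8452), (176639, 7106), (200191, 1984), (207359, 7106),
    (209407, 10244), (238079, 8452), (246271, 5212)], [(16383, 7784), (146943, 13664),
    (193023, 9090), (208383, 9090), (211455, 25802), (242175, 25802), (246783, 5212),
    (254463, 13664)], [(147455, 21448), (212479, 48556), (244223, 51604), (254975, 18876),
    (258559, 48556)], [(212991, 70004), (245247, 100160), (259071, 67432), (260607, 100160)],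
    [(229375, 70004), (245759, 170164), (260095, 67432), (261119, 167592), (261631, 200320)],
    [(262143, 675512)]]

/-- The incidence vectors of the 18 elements with the members of the family. -/
def chainColumns : List ℕ :=
  [5986310706507378352962292997358493444648262552171842,
    5986310706507378352952131946792338141420676128939204,
    5986310706507378185498017996402608295509602199637128,
    5986310706505974478870940637643389449523309713131520,
    5986310704937602405442486858314944842721190383517696,
    5986310706507378352957212549522817596896906543264528,
    5986310706507378269230155574327952673941386775257632,
    5986310706506676415916616894948343251018954568646656,
    5986310705722490379202390005284120947969617599397888,
    4427117534822721051609103857741189123830635026186240,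
    5162579720771499712397730524149538217556445702914048,
    5584234411310657670583485726640208060141488876552192,
    5984705877643012309496909293935658322169141582102528,
    5986264655152678271397232872908019723827196465250304,
    5780379205778523214556434831170194694515347469369344,
    5886361100050725512118577925377280868341425119428608,
    5986123001472685175691241940751693581326509796229120,
    5986309987651434734759640552760443686656262262489088]

lemma checkCounts_chainTable : checkCounts 18 [(0, 1)] chainTable = true := by decide +kernel

lemma map_column_chainTable : (List.range 18).map
    (fun x => column x (0 :: chainTable.flatten.map Prod.fst)) = chainColumns := by
  decide +kernel

lemma checkTraces_chainColumns : checkTraces chainColumns = true := by decide +kernel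

theorem le_f_eighteen : 675512 ≤ f 18 :=
  le_f_of_check checkCounts_chainTable map_column_chainTable checkTraces_chainColumns
    (by decide +kernel)

/-! ### The growth rate -/

/-- The negative logarithm of the maximum size of a Condorcet domain on `n + 1` alternatives. -/
noncomputable def negLogSize (n : ℕ) : ℝ := -Real.log (f (n + 1))

lemma cast_f_pos (n : ℕ) : (0 : ℝ) < f n := by exact_mod_cast one_le_f n

lemma subadditive_negLogSize : Subadditive negLogSize := by
  intro n m
  have h : (f (n + 1) : ℝ) * f (m + 1) ≤ f (n + m + 1) := by exact_mod_cast f_mul_f_le n m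
  have h2 := Real.log_le_log (mul_pos (cast_f_pos _) (cast_f_pos _)) h
  rw [Real.log_mul (cast_f_pos _).ne' (cast_f_pos _).ne'] at h2
  simp only [negLogSize]
  linarith

/-- This is where the exponential upper bound enters: it keeps the limit finite. -/
lemma bddBelow_negLogSize : BddBelow (Set.range fun n : ℕ => negLogSize n / n) := by
  refine ⟨-(Real.log (f 2) + Real.log 12), ?_⟩
  have hf : 0 ≤ Real.log (f 2) := Real.log_nonneg (by exact_mod_cast one_le_f 2)
  have h12 : 0 ≤ Real.log 12 := Real.log_nonneg (by norm_num)
  rintro _ ⟨n, rfl⟩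
  rcases n with _ | k
  -- At index `0` the quotient is `0` by convention.
  · simp only [Nat.cast_zero, div_zero]
    linarith
  · have h : (f (k + 2) : ℝ) ≤ f 2 * 12 ^ k := by exact_mod_cast f_le k
    have h2 := Real.log_le_log (cast_f_pos _) h
    rw [Real.log_mul (cast_f_pos _).ne' (by positivity), Real.log_pow] at h2
    have hk : (0 : ℝ) ≤ k := Nat.cast_nonneg k
    simp only [negLogSize]
    rw [le_div_iff₀ (by positivity)]
    push_cast
    nlinarith [mul_nonneg hk hf]

lemma tendsto_f_rpow : Tendsto (fun n : ℕ => (f n : ℝ) ^ (1 / (n : ℝ))) atTop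
    (𝓝 (Real.exp (-subadditive_negLogSize.lim))) := by
  have h1 := subadditive_negLogSize.tendsto_lim bddBelow_negLogSize
  -- The factor `n / (n + 1)` corrects the index shift: Fekete gives the exponent `1 / n` for `f (n
  -- + 1)`, not `1 / (n + 1)`.
  have h2 : Tendsto (fun n : ℕ => (n : ℝ) / (n + 1)) atTop (𝓝 1) :=
    tendsto_natCast_div_add_atTop 1
  have h3 := (Real.continuous_exp.tendsto _).comp (h1.mul h2).neg
  rw [mul_one] at h3
  rw [← tendsto_add_atTop_iff_nat 1]
  refine h3.congr' ?_
  filter_upwards [eventually_gt_atTop 0] with n hn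
  have hn' : (n : ℝ) ≠ 0 := by exact_mod_cast hn.ne'
  rw [Real.rpow_def_of_pos (cast_f_pos _)]
  simp only [Function.comp_apply, negLogSize]
  congr 1
  push_cast
  field_simp

/-- The Fekete limit lies below every quotient `negLogSize k / k`, so a single `k` bounds the growth
rate. -/
lemma le_exp_neg_lim {c : ℝ} (hc : 0 < c) {k : ℕ} (hk : k ≠ 0) (h : c ^ k ≤ f (k + 1)) :
    c ≤ Real.exp (-subadditive_negLogSize.lim) := by
  have h1 := subadditive_negLogSize.lim_le_div bddBelow_negLogSize hk
  have hk' : (0 : ℝ) < k := by exact_mod_cast Nat.pos_of_ne_zero hk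
  have h2 := Real.log_le_log (pow_pos hc k) h
  rw [Real.log_pow] at h2
  rw [← Real.log_le_iff_le_exp hc]
  rw [le_div_iff₀ hk'] at h1
  simp only [negLogSize] at h1
  nlinarith

lemma pow_mul_le_f {c : ℝ} (hc : 0 ≤ c) {k : ℕ} (h : c ^ k ≤ f (k + 1)) (q : ℕ) :
    c ^ (k * q) ≤ f (k * q + 1) := by
  induction q with
  | zero => simpa using one_le_f 1
  | succ q ih =>
    have h1 : (f (k * q + 1) : ℝ) * f (k + 1) ≤ f (k * q + k + 1) := by
      exact_mod_cast f_mul_f_le (k * q) k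
    rw [Nat.mul_succ, pow_add]
    exact (mul_le_mul ih h (pow_nonneg hc _) (Nat.cast_nonneg _)).trans h1

lemma monotone_f : Monotone fun n => f (n + 1) := by
  refine monotone_nat_of_le_succ fun n => ?_
  calc f (n + 1) ≤ f (n + 1) * f (1 + 1) := Nat.le_mul_of_pos_right _ (one_le_f 2)
    _ ≤ f (n + 1 + 1) := f_mul_f_le n 1

lemma isBigO_pow_f {c : ℝ} (hc : 1 ≤ c) {k : ℕ} (hk : k ≠ 0) (h : c ^ k ≤ f (k + 1)) :
    (fun n : ℕ => c ^ n) =O[atTop] fun n => (f n : ℝ) := by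
  -- Rounding `n` down to a multiple of `k` costs fewer than `k` factors `c`, and the index shift
  -- one more.
  refine IsBigO.of_bound (c ^ (k + 1)) ?_
  filter_upwards [eventually_gt_atTop 0] with n hn
  obtain ⟨n, rfl⟩ := Nat.exists_eq_succ_of_ne_zero hn.ne'
  have hc0 : 0 ≤ c := zero_le_one.trans hc
  rw [Real.norm_of_nonneg (pow_nonneg hc0 _), Real.norm_of_nonneg (Nat.cast_nonneg _)]
  have hmod := Nat.mod_lt n (Nat.pos_of_ne_zero hk)
  have hdiv := Nat.div_add_mod n k
  have h1 : (f (k * (n / k) + 1) : ℝ) ≤ f (n + 1) := by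
    exact_mod_cast monotone_f (show k * (n / k) ≤ n by omega)
  calc c ^ (n + 1) ≤ c ^ (k + 1 + k * (n / k)) := pow_le_pow_right₀ hc (by omega)
    _ = c ^ (k + 1) * c ^ (k * (n / k)) := pow_add _ _ _
    _ ≤ c ^ (k + 1) * f (n + 1) :=
      mul_le_mul_of_nonneg_left ((pow_mul_le_f hc0 h _).trans h1) (pow_nonneg hc0 _)

lemma pow_seventeen_le_f : (2.198139 : ℝ) ^ 17 ≤ f (17 + 1) := by
  have h : (675512 : ℝ) ≤ f (17 + 1) := by exact_mod_cast le_f_eighteen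
  exact le_trans (by norm_num) h

end CondorcetDomain

theorem mainTheorem1 :
    (∃ L : ℝ,
      Tendsto (fun n : ℕ => (CondorcetDomain.f n : ℝ) ^ (1 / (n : ℝ))) atTop (𝓝 L) ∧
        (2.198139 : ℝ) ≤ L) ∧
    (fun n : ℕ => (2.198139 : ℝ) ^ n) =O[atTop] (fun n : ℕ => (CondorcetDomain.f n : ℝ)) :=
  ⟨⟨_, CondorcetDomain.tendsto_f_rpow,
    CondorcetDomain.le_exp_neg_lim (by norm_num) (by norm_num)
      CondorcetDomain.pow_seventeen_le_f⟩,
    CondorcetDomain.isBigO_pow_f (by norm_num) (by norm_num) CondorcetDomain.pow_seventeen_le_f⟩
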